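/- Let $s\ge 2$ be an integer, $q=2s+1$, $J>0$. On a chain of $n$ spins with local basis $|j\rangle$, $j\in\{-s,\dots,s\}$, and open boundary, let $H_n=H_n^J+H_n^s$, where $$H_n^J=J\sum_{k=1}^n(|0\rangle\langle 0|)_k,\qquad H_n^s=\sum_{k=1}^{n-1}\Big\{\sum_{m=-s}^{s}P^m_{k,k+1}+\sum_{m=1}^{s}Q^m_{k,k+1}\Big\},$$ $P^m$ and $Q^m$ being $|v\rangle\langle v|$ for $v=\tfrac1{\sqrt2}(|0,m\rangle-|m,0\rangle)$ and $v=\tfrac1{\sqrt2}(|0,0\rangle-|m,-m\rangle)$ respectively, acting on sites $k,k+1$. Put $\mathrm{Ent}_r(x)=-x\log_r x-(1-x)\log_r(1-x)+x\log_r(r-1)$, with $0\log 0=0$. A quantum code in $\ker H_n$ encoding one logical qubit is given by orthonormal $|0_L\rangle,|1_L\rangle\in\ker H_n$. It has distance (at least) $d$, for a real $d$, if for every generalized Pauli operator $P=X^{a_1}Z^{b_1}\otimes\cdots\otimes X^{a_n}Z^{b_n}$ (with $X=\sum_j|j\rangle\langle j+1|$ cyclic, $Z=\sum_j\omega^j|j\rangle\langle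 j|$, $\omega=e^{2\pi i/q}$) such that $\mathrm{wt}(a)<d$ and $\mathrm{wt}(b)<d$ there is $\gamma\in\mathbb C$ with $\langle i_L|P|j_L\rangle=\gamma\,\delta_{ij}$ for $i,j\in\{0,1\}$. (In particular this holds for all Pauli operators acting nontrivially on fewer than $d$ sites.) **(1) Existence.** There is a sequence $\varepsilon_n\to0$, depending only on $s$, such that for all $n$ and all $0<\tau\le 1/2$ with $$\mathrm{Ent}_2(2\tau)+\mathrm{Ent}_{2s+1}(2\tau)\log_2(2s+1)+\varepsilon_n\le 1$$ there is a quantum code in $\ker H_n$ that encodes one logical qubit and has distance $2\tau n$. **(2) Explicit codes.** Let $0<\tau\le1/2$ satisfy $$\tfrac12-\frac{\tau}{0.11}\;\ge\;\log_2(2s+1)\,\mathrm{Ent}_{2s+1}(2\tau).$$ Then for all sufficiently large $n$ the following explicit construction gives codes of distance $2\tau n$. Let $m$ be the integer with $2(m-1)(2^{m-1}-1)<n\le 2m(2^m-1)$, let $R=\tfrac12-\tau/0.11$ and $K=\lceil nR/m\rceil+1$, take any primitive element $\alpha$ of $\mathbb F_{2^m}$ and any $\mathbb F_2$-linear identification $\mathbb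 F_{2^m}\cong\mathbb F_2^m$. Let $C\subset\{1,2\}^n$ consist of the first $n$ bits of the binary Justesen codewords $\big(f(\alpha^i),\,\alpha^if(\alpha^i)\big)_{0\le i<2^m-1}$, $f\in\mathbb F_{2^m}[X]$, $\deg f<K$, with bits replaced by $0\mapsto2$, $1\mapsto1$. (If $n=2m(2^m-1)$, these are the whole Justesen codewords.) Let $A$ be the real matrix with columns indexed by $c\in C$, with one row of ones, and with rows $\mathrm{Re}\,\langle c|P|c\rangle$ and $\mathrm{Im}\,\langle c|P|c\rangle$ for every diagonal Pauli operator $P=Z^{z_1}\otimes\cdots\otimes Z^{z_n}$ with $0<\mathrm{wt}(z)<2\tau n$. Then $A$ has a nonzero real kernel vector, and for every nonzero real $x$ with $Ax=0$ the states $$|0_L\rangle=\frac{\sum_{c\in C}\sqrt{x_c^+}\,|c\rangle}{\sqrt{\sum_{c} x_c^+}},\qquad |1_L\rangle=\frac{\sum_{c\in C}\sqrt{x_c^-}\,|c\rangle}{\sqrt{\sum_{c} x_c^-}},\qquad x^\pm_c=\max(\pm x_c,0),$$ form a quantum code in $\ker H_n$ that encodes one logical qubit and has distance $2\tau n$. 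-/

import Mathlib

open Filter Topology

namespace SpinChain

/-- The letters `-s, …, s`: labels of the basis states of one spin-`s` particle. -/
abbrev Spin (s : ℕ) : Type := ↥(Finset.Icc (-(s : ℤ)) (s : ℤ))

/-- The letter `0`. -/
def Spin.zero (s : ℕ) : Spin s := ⟨0, by simp⟩

/-- The letter `-m`. -/
def Spin.opp {s : ℕ} (m : Spin s) : Spin s :=
  ⟨-(m : ℤ), by have h := Finset.mem_Icc.mp m.2; rw [Finset.mem_Icc]; omega⟩

/-- The cyclic successor: `j ↦ j + 1`, with `s + 1 = -s`. -/
def Spin.succ {s : ℕ} (j : Spin s) : Spin s :=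
  if h : (j : ℤ) < s then
    ⟨(j : ℤ) + 1, by have h' := Finset.mem_Icc.mp j.2; rw [Finset.mem_Icc]; omega⟩
  else ⟨-(s : ℤ), by rw [Finset.mem_Icc]; omega⟩

/-- Strings of length `n`: labels of the product basis of a chain of `n` spins. -/
abbrev Config (s n : ℕ) : Type := Fin n → Spin s

/-- The Hilbert space of `n` spins. -/
abbrev State (s n : ℕ) : Type := EuclideanSpace ℂ (Config s n)

/-- Operators on `n` spins, as matrices in the product basis. -/
abbrev Op (s n : ℕ) : Type := Matrix (Config s n) (Config s n) ℂ

/-- The product basis state `|c⟩`. -/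
noncomputable def ket {s n : ℕ} (c : Config s n) : State s n := EuclideanSpace.single c 1

/-- The operator `h` on site `k`, tensored with the identity on all other sites. -/
def oneSite {s n : ℕ} (k : Fin n) (h : Matrix (Spin s) (Spin s) ℂ) : Op s n :=
  fun c c' => if ∀ l, l ≠ k → c l = c' l then h (c k) (c' k) else 0

/-- The operator `h` on the sites `k`, `k'` (with `k ≠ k'`), tensored with the identity on all
other sites. -/
def twoSite {s n : ℕ} (k k' : Fin n) (h : Matrix (Spin s × Spin s) (Spin s × Spin s) ℂ) :
    Op s n :=
  fun c c' => if ∀ l, l ≠ k → l ≠ k' → c l = c' l then h (c k, c k') (c' k, c' k') else 0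

/-- The vector `(|0,m⟩ - |m,0⟩)/√2` of two spins. -/
noncomputable def transportVec {s : ℕ} (m : Spin s) : Spin s × Spin s → ℂ :=
  ((1 / Real.sqrt 2 : ℝ) : ℂ) •
    (Pi.single (Spin.zero s, m) (1 : ℂ) - Pi.single (m, Spin.zero s) (1 : ℂ))

/-- The vector `(|0,0⟩ - |m,-m⟩)/√2` of two spins. -/
noncomputable def pairVec {s : ℕ} (m : Spin s) : Spin s × Spin s → ℂ :=
  ((1 / Real.sqrt 2 : ℝ) : ℂ) •
    (Pi.single (Spin.zero s, Spin.zero s) (1 : ℂ) - Pi.single (m, m.opp) (1 : ℂ))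

/-- The rank-one operator `|v⟩⟨v|` of two spins. -/
def rankOne {s : ℕ} (v : Spin s × Spin s → ℂ) :
    Matrix (Spin s × Spin s) (Spin s × Spin s) ℂ :=
  Matrix.vecMulVec v (star v)

/-- The two-spin interaction `∑_{m=-s}^{s} P^m + ∑_{m=1}^{s} Q^m`. -/
noncomputable def interaction (s : ℕ) : Matrix (Spin s × Spin s) (Spin s × Spin s) ℂ :=
  (∑ m : Spin s, rankOne (transportVec m)) +
    ∑ m : Spin s, if 0 < (m : ℤ) then rankOne (pairVec m) else 0

/-- `H_n^s`: the interaction summed over all pairs of neighbouring sites (open boundary). -/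
noncomputable def hamS (s n : ℕ) : Op s n :=
  ∑ k : Fin (n - 1),
    twoSite (⟨k, by omega⟩ : Fin n) (⟨k + 1, by omega⟩ : Fin n) (interaction s)

/-- `H_n^J = J ∑_k (|0⟩⟨0|)_k`. -/
noncomputable def hamJ (s n : ℕ) (J : ℝ) : Op s n :=
  (J : ℂ) • ∑ k : Fin n, oneSite k (Matrix.single (Spin.zero s) (Spin.zero s) (1 : ℂ))

/-- `H_n = H_n^J + H_n^s`. -/
noncomputable def ham (s n : ℕ) (J : ℝ) : Op s n := hamJ s n J + hamS s n

/-- The kernel of `H_n`. -/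
noncomputable def groundSpace (s n : ℕ) (J : ℝ) : Submodule ℂ (State s n) :=
  LinearMap.ker (Matrix.toEuclideanLin (ham s n J))

/-- The generalized Pauli matrix `X = ∑_j |j⟩⟨j+1|` (cyclic). -/
def pauliX (s : ℕ) : Matrix (Spin s) (Spin s) ℂ :=
  fun i j => if j = i.succ then 1 else 0

/-- The generalized Pauli matrix `Z = ∑_j ω^j |j⟩⟨j|`, `ω = exp (2πi/(2s+1))`. -/
noncomputable def pauliZ (s : ℕ) : Matrix (Spin s) (Spin s) ℂ :=
  Matrix.diagonal fun j =>
    Complex.exp (2 * Real.pi * Complex.I / (2 * s + 1)) ^ (j : ℤ)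

/-- `X^{a₁} Z^{b₁} ⊗ ⋯ ⊗ X^{aₙ} Z^{bₙ}`. -/
noncomputable def pauli {s n : ℕ} (a b : Fin n → Fin (2 * s + 1)) : Op s n :=
  fun c c' => ∏ k, (pauliX s ^ (a k : ℕ) * pauliZ s ^ (b k : ℕ)) (c k) (c' k)

/-- The Knill–Laflamme conditions for the span of `ψ 0`, `ψ 1`, for all generalized Pauli operators
whose bit-flip weight is less than `dX` and whose phase-flip weight is less than `dZ`. -/
def HasBitPhaseDistance {s n : ℕ} (ψ : Fin 2 → State s n) (dX dZ : ℝ) : Prop :=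
  ∀ a b : Fin n → Fin (2 * s + 1), (hammingNorm a : ℝ) < dX → (hammingNorm b : ℝ) < dZ →
    ∃ γ : ℂ, ∀ i j : Fin 2,
      inner ℂ (ψ i) (Matrix.toEuclideanLin (pauli a b) (ψ j)) = if i = j then γ else 0

/-- The code spanned by `ψ 0`, `ψ 1` has distance (at least) `d`: both the bit-flip and the
phase-flip distance are at least `d`. In particular, the Knill–Laflamme conditions hold for every
Pauli operator that acts nontrivially on fewer than `d` sites. -/
def HasDistance {s n : ℕ} (ψ : Fin 2 → State s n) (d : ℝ) : Prop :=
  HasBitPhaseDistance ψ d d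

/-- `ψ 0`, `ψ 1` are the logical states of a quantum code that encodes one logical qubit in the
kernel of `H_n`. -/
def IsGroundCode {s n : ℕ} (J : ℝ) (ψ : Fin 2 → State s n) : Prop :=
  Orthonormal ℂ ψ ∧ ∀ i, ψ i ∈ groundSpace s n J

/-- The `q`-ary entropy function. -/
noncomputable def Ent (q : ℕ) (x : ℝ) : ℝ :=
  -x * Real.logb q x - (1 - x) * Real.logb q (1 - x) + x * Real.logb q (q - 1)

/-! ### The quantum code of a classical code -/

/-- The real matrix `A` of a classical code `C`: its columns are labelled by the codewords; its
first row consists of ones, and every diagonal Pauli operator `P` of weight `w` with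
`0 < w < d` gives a row of the numbers `Re ⟨c|P|c⟩` and a row of the numbers `Im ⟨c|P|c⟩`. -/
noncomputable def constraintMatrix {s n : ℕ} (C : Finset (Config s n)) (d : ℝ) :
    Matrix (Unit ⊕ {z : Fin n → Fin (2 * s + 1) //
      0 < hammingNorm z ∧ (hammingNorm z : ℝ) < d} × Fin 2) C ℝ :=
  fun r c => match r with
    | Sum.inl _ => 1
    | Sum.inr (z, i) =>
        if i = 0 then (pauli 0 z.1 c.1 c.1).re else (pauli 0 z.1 c.1 c.1).im

/-- `(∑_c v_c)^{-1/2} ∑_c √(v_c) |c⟩`, for nonnegative coefficients `v`. -/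
noncomputable def sqrtState {s n : ℕ} {C : Finset (Config s n)} (v : C → ℝ) : State s n :=
  ((1 / Real.sqrt (∑ c, v c) : ℝ) : ℂ) • ∑ c, ((Real.sqrt (v c) : ℝ) : ℂ) • ket c.1

/-- The logical states of a balanced vector `x`, from its positive and its negative part. -/
noncomputable def logicalStates {s n : ℕ} {C : Finset (Config s n)} (x : C → ℝ) :
    Fin 2 → State s n :=
  ![sqrtState fun c => max (x c) 0, sqrtState fun c => max (-x c) 0]

/-! ### Justesen codes -/

/-- The length `2m(2^m - 1)` of the binary Justesen codes over the field of `2^m` elements. -/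
def justesenLength (m : ℕ) : ℕ := 2 * m * (2 ^ m - 1)

/-- The first `n` bits of the Justesen codeword of the polynomial `f`. The outer codeword is
`(f(1), f(α), f(α²), …)` (Reed–Solomon); its `i`-th symbol `u = f(α^i)` is encoded by the `i`-th
inner code into the `2m` bits of the pair `(u, α^i u)`, where `e` reads the `m` bits of a field
element. For `n = justesenLength m` and `α` primitive this is the whole codeword. -/
noncomputable def justesenWord {m : ℕ} (n : ℕ) (α : GaloisField 2 m)
    (e : GaloisField 2 m ≃ₗ[ZMod 2] (Fin m → ZMod 2)) (f : Polynomial (GaloisField 2 m)) :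
    Fin n → ZMod 2 :=
  fun k =>
    let i := (k : ℕ) / (2 * m)
    let r := (k : ℕ) % (2 * m)
    let u := f.eval (α ^ i)
    if h : r < m then e u ⟨r, h⟩
    else if h' : r - m < m then e (α ^ i * u) ⟨r - m, h'⟩
    else 0

/-- The map `β` from bits to spin letters, `0 ↦ 2` and `1 ↦ 1`. -/
def beta {s : ℕ} (hs : 2 ≤ s) (b : ZMod 2) : Spin s :=
  if b = 0 then ⟨2, by rw [Finset.mem_Icc]; omega⟩ else ⟨1, by rw [Finset.mem_Icc]; omega⟩

open Classical in
/-- The image under `β` of the Justesen code with a `K`-dimensional Reed–Solomon outer code,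
restricted to the first `n` bits. -/
noncomputable def justesenCode {s m : ℕ} (hs : 2 ≤ s) (n K : ℕ) (α : GaloisField 2 m)
    (e : GaloisField 2 m ≃ₗ[ZMod 2] (Fin m → ZMod 2)) : Finset (Config s n) :=
  {t | ∃ f : Polynomial (GaloisField 2 m), f.degree < K ∧
    t = fun k => beta hs (justesenWord n α e f k)}

/-- The outer dimension `⌈nR/m⌉ + 1`, which makes the rate `mK/n` of the code approach `R`
from above. -/
noncomputable def outerDim (R : ℝ) (n m : ℕ) : ℕ := ⌈(n : ℝ) * R / m⌉₊ + 1

end SpinChain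

open SpinChain

open Filter Topology

namespace SpinChain

/-! Every term of `ham` kills a product state whose letters are all positive, so the strings over
{1, 2} span a subspace of the ground space for every `J` (`ket_mem_groundSpace`). Take a classical
code `C` of distance at least `d` inside it. A Pauli operator with nonzero shift part `a` of weight
below `d` has no matrix elements between codewords: it cannot join two different ones, and it fixes
none. Only the diagonal operators remain, and on superpositions with disjoint supports they see only
the squared amplitudes. So it suffices that the positive and negative parts of some real `x` give
each such operator equal expectations, which is the linear system of `constraintMatrix`
(`knillLaflamme_of_balanced`). With `V` the size of the `q`-ary ball of radius `d`, it has at most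
`2V - 1` equations, so `2V ≤ |C|` yields a solution (`exists_balanced`).

What remains is classical coding: the entropy bound for `V`, and a large `C` from the
Gilbert–Varshamov bound for existence or from Justesen codes for the explicit family. In a Justesen
word the nonzero blocks are distinct, and few vectors have relative weight below some `l > 0.11`,
because the binary entropy of 0.11 is below 1/2; hence most blocks are heavy
(`hammingNorm_justesenWord_ge`). -/

/-! ### Entropy bound for Hamming balls -/

/-- The entropy function of an alphabet of size `q`, in nats. -/
noncomputable def natEnt (q x : ℝ) : ℝ :=
  -x * Real.log x - (1 - x) * Real.log (1 - x) + x * Real.log (q - 1)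

theorem Ent_mul_log (q : ℕ) (hq : 2 ≤ q) (x : ℝ) : Ent q x * Real.log q = natEnt q x := by
  have h : Real.log q ≠ 0 := (Real.log_pos (by exact_mod_cast hq)).ne'
  unfold Ent natEnt Real.logb
  field_simp

/-- The weight enumerator of the full space factors over the coordinates. -/
theorem sum_pow_hammingNorm {α : Type*} [Fintype α] [DecidableEq α] [Zero α] (n : ℕ) (t : ℝ) :
    ∑ z : Fin n → α, t ^ hammingNorm z = (1 + ((Fintype.card α : ℝ) - 1) * t) ^ n := by
  have h1 : ∑ a : α, (if a ≠ 0 then t else 1) = 1 + ((Fintype.card α : ℝ) - 1) * t := by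
    rw [← Finset.add_sum_erase _ _ (Finset.mem_univ (0 : α))]
    rw [Finset.sum_congr rfl (g := fun _ => t)]
    · rw [Finset.sum_const, Finset.card_erase_of_mem (Finset.mem_univ _), Finset.card_univ,
        nsmul_eq_mul, Nat.cast_sub (Fintype.card_pos_iff.mpr ⟨0⟩)]
      simp
    · intro a ha
      simp [Finset.ne_of_mem_erase ha]
  have h2 : ∀ z : Fin n → α, t ^ hammingNorm z = ∏ k, if z k ≠ 0 then t else 1 := by
    intro z
    rw [Finset.prod_ite, Finset.prod_const, Finset.prod_const_one, mul_one]
    rfl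
  simp_rw [h2]
  rw [← h1, ← Fin.prod_const, Fintype.prod_sum]

/-- Chernoff's argument: give each vector the weight `t ^ hammingNorm z`. With `t ≤ 1`, vectors of
the ball weigh at least `t ^ (x * n)`, and the total is `(1 / (1 - x)) ^ n` for the optimal `t = x /
((1 - x) * (q - 1))`. The bound `x ≤ 1 / 2` ensures `t ≤ 1` for every `q ≥ 2`. -/
theorem card_hammingBall_le {α : Type*} [Fintype α] [DecidableEq α] [Zero α] (n : ℕ) {x : ℝ}
    (hx0 : 0 < x) (hα : 2 ≤ Fintype.card α) (hx : x ≤ 1 / 2) :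
    ((Finset.univ.filter fun z : Fin n → α => (hammingNorm z : ℝ) ≤ x * n).card : ℝ) ≤
      Real.exp (n * natEnt (Fintype.card α) x) := by
  set q : ℝ := (Fintype.card α : ℝ) with hq
  have hq2 : (2 : ℝ) ≤ q := by rw [hq]; exact_mod_cast hα
  have hx1 : 0 < 1 - x := by linarith
  have hq1 : 0 < q - 1 := by linarith
  set t : ℝ := x / ((1 - x) * (q - 1)) with ht
  have ht0 : 0 < t := by positivity
  have ht1 : t ≤ 1 := by
    rw [ht, div_le_one (by positivity)]
    nlinarith
  have hsum : 1 + (q - 1) * t = 1 / (1 - x) := by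
    rw [ht]; field_simp; ring
  have hkey : ((Finset.univ.filter fun z : Fin n → α => (hammingNorm z : ℝ) ≤ x * n).card : ℝ) *
      t ^ (x * n) ≤ (1 / (1 - x)) ^ n := by
    rw [← hsum, ← sum_pow_hammingNorm, ← nsmul_eq_mul, ← Finset.sum_const]
    refine (Finset.sum_le_sum fun z hz => ?_).trans
      (Finset.sum_le_univ_sum_of_nonneg fun z => pow_nonneg ht0.le _)
    rw [← Real.rpow_natCast]
    exact Real.rpow_le_rpow_of_exponent_ge ht0 ht1 (Finset.mem_filter.mp hz).2
  have hexp : Real.exp (n * natEnt q x) * t ^ (x * n) = (1 / (1 - x)) ^ n := by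
    rw [← Real.rpow_natCast, Real.rpow_def_of_pos ht0, Real.rpow_def_of_pos (by positivity),
      ← Real.exp_add, ht, Real.log_div hx0.ne' (by positivity), Real.log_mul hx1.ne' hq1.ne',
      Real.log_div one_ne_zero hx1.ne', Real.log_one, natEnt]
    congr 1
    ring
  rw [← hexp] at hkey
  exact le_of_mul_le_mul_right hkey (Real.rpow_pos_of_pos ht0 _)

theorem card_openHammingBall_le {α : Type*} [Fintype α] [DecidableEq α] [Zero α] (n : ℕ) {x : ℝ}
    (hx0 : 0 < x) (hα : 2 ≤ Fintype.card α) (hx : x ≤ 1 / 2) :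
    ((Finset.univ.filter fun z : Fin n → α => (hammingNorm z : ℝ) < x * n).card : ℝ) ≤
      Real.exp (n * natEnt (Fintype.card α) x) := by
  refine le_trans ?_ (card_hammingBall_le n hx0 hα hx)
  exact_mod_cast Finset.card_le_card
    (Finset.monotone_filter_right _ fun _ _ h => le_of_lt h)

/-! ### Greedy codes and the dimension count -/

/-- The Gilbert–Varshamov bound. -/
theorem exists_code_card_mul_ball_ge (n : ℕ) (d : ℝ) (hd : 0 < d) :
    ∃ B : Finset (Fin n → ZMod 2), (∀ c ∈ B, ∀ c' ∈ B, c ≠ c' → d ≤ hammingDist c c') ∧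
      2 ^ n ≤ B.card * (Finset.univ.filter fun z : Fin n → ZMod 2 =>
        (hammingNorm z : ℝ) < d).card := by
  classical
  -- A code maximal under inclusion: a word outside all the balls around it could be added.
  obtain ⟨B, hB⟩ := (Set.toFinite {B : Finset (Fin n → ZMod 2) |
    ∀ c ∈ B, ∀ c' ∈ B, c ≠ c' → d ≤ hammingDist c c'}).exists_maximal ⟨∅, by simp⟩
  refine ⟨B, hB.prop, ?_⟩
  have hcover : (Finset.univ : Finset (Fin n → ZMod 2)) ⊆ B.biUnion fun c =>
      (Finset.univ.filter fun z : Fin n → ZMod 2 => (hammingNorm z : ℝ) < d).image (c + ·) := by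
    intro w _
    by_contra hw
    have hfar : ∀ c ∈ B, d ≤ hammingDist c w := by
      intro c hc
      by_contra hlt
      refine hw (Finset.mem_biUnion.mpr ⟨c, hc, Finset.mem_image.mpr ⟨-c + w, ?_, by simp⟩⟩)
      rw [Finset.mem_filter, ← hammingDist_eq_hammingNorm]
      exact ⟨Finset.mem_univ _, not_le.mp hlt⟩
    have hmem : w ∈ B := by
      have hins : insert w B ≤ B := hB.le_of_ge (by
        intro c hc c' hc' hne
        rcases Finset.mem_insert.mp hc with rfl | hcB <;>
          rcases Finset.mem_insert.mp hc' with rfl | hcB'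
        · exact absurd rfl hne
        · rw [hammingDist_comm]; exact hfar _ hcB'
        · exact hfar _ hcB
        · exact hB.prop c hcB c' hcB' hne) (Finset.subset_insert _ _)
      exact hins (Finset.mem_insert_self _ _)
    have := hfar w hmem
    rw [hammingDist_self] at this
    simp at this
    linarith
  have h1 := Finset.card_le_card hcover
  rw [Finset.card_univ, Fintype.card_fun, ZMod.card, Fintype.card_fin] at h1
  refine h1.trans (Finset.card_biUnion_le_card_mul _ _ _ fun c _ => Finset.card_image_le)

/-- A code larger than twice a Hamming ball has balanced vectors. -/
theorem exists_balanced {s n : ℕ} (C : Finset (Config s n)) (d : ℝ) (hd : 0 < d)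
    (hC : 2 * (Finset.univ.filter fun z : Fin n → Fin (2 * s + 1) =>
      (hammingNorm z : ℝ) < d).card ≤ C.card) :
    ∃ x : C → ℝ, x ≠ 0 ∧ (constraintMatrix C d).mulVec x = 0 := by
  classical
  have hlt : Module.finrank ℝ ((Unit ⊕ {z : Fin n → Fin (2 * s + 1) //
      0 < hammingNorm z ∧ (hammingNorm z : ℝ) < d} × Fin 2) → ℝ) <
      Module.finrank ℝ (C → ℝ) := by
    rw [Module.finrank_fintype_fun_eq_card, Module.finrank_fintype_fun_eq_card, Fintype.card_sum,
      Fintype.card_prod, Fintype.card_coe, Fintype.card_fin, Fintype.card_unit,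
      Fintype.card_subtype]
    -- The zero vector is in the ball but gives no Pauli row, so there are at most `1 + 2(V - 1) <
    -- 2V` rows.
    have hss : (Finset.univ.filter fun z : Fin n → Fin (2 * s + 1) =>
        0 < hammingNorm z ∧ (hammingNorm z : ℝ) < d).card <
        (Finset.univ.filter fun z : Fin n → Fin (2 * s + 1) => (hammingNorm z : ℝ) < d).card := by
      refine Finset.card_lt_card ⟨Finset.monotone_filter_right _ fun _ _ h => h.2, fun h => ?_⟩
      have := h (Finset.mem_filter.mpr ⟨Finset.mem_univ 0, by simpa using hd⟩)
      simp at this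
    omega
  have hker := LinearMap.ker_ne_bot_of_finrank_lt (f := (constraintMatrix C d).mulVecLin) hlt
  obtain ⟨x, hx, hx0⟩ := Submodule.exists_mem_ne_zero_of_ne_bot hker
  exact ⟨x, hx0, hx⟩

/-! ### The constant 0.11 -/

theorem natEnt_two_lt : natEnt 2 0.11 < Real.log 2 / 2 := by
  -- The claim multiplied by 100 and exponentiated.
  have h : (100 : ℝ) ^ 100 < 2 ^ 50 * 11 ^ 11 * 89 ^ 89 := by norm_num
  have h' := Real.log_lt_log (by positivity) h
  rw [Real.log_mul (by positivity) (by positivity), Real.log_mul (by positivity) (by positivity),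
    Real.log_pow, Real.log_pow, Real.log_pow, Real.log_pow] at h'
  have e1 : Real.log 0.11 = Real.log 11 - Real.log 100 := by
    rw [← Real.log_div (by norm_num) (by norm_num)]; norm_num
  have e2 : Real.log (1 - 0.11) = Real.log 89 - Real.log 100 := by
    rw [← Real.log_div (by norm_num) (by norm_num)]; norm_num
  have e3 : Real.log ((2 : ℝ) - 1) = 0 := by norm_num
  rw [natEnt, e1, e2, e3]
  push_cast at h'
  linarith

/-- By continuity. The room between 0.11 and `l` later absorbs all lower-order losses in the
Justesen distance. -/
theorem exists_natEnt_two_lt : ∃ l : ℝ, 0.11 < l ∧ l ≤ 1 / 2 ∧ natEnt 2 l < Real.log 2 / 2 := by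
  have hc : ContinuousAt (natEnt 2) 0.11 := by
    unfold natEnt
    have h1 : ContinuousAt Real.log (0.11 : ℝ) := Real.continuousAt_log (by norm_num)
    have h2 : ContinuousAt (fun x : ℝ => Real.log (1 - x)) 0.11 :=
      ContinuousAt.log (by fun_prop) (by norm_num)
    fun_prop
  have h1 := (hc.eventually_lt continuousAt_const natEnt_two_lt).filter_mono
    (nhdsWithin_le_nhds (s := Set.Ioi 0.11))
  have h2 : ∀ᶠ l in 𝓝[>] (0.11 : ℝ), l ∈ Set.Ioo (0.11 : ℝ) (1 / 2) :=
    Ioo_mem_nhdsGT (by norm_num)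
  obtain ⟨l, hl, hl'⟩ := (h1.and h2).exists
  exact ⟨l, hl'.1, hl'.2.le, hl⟩

/-! ### Matrix elements of Pauli operators -/

theorem Spin.dvd_succ_iterate_sub {s : ℕ} (j : Spin s) (a : ℕ) :
    (2 * s + 1 : ℤ) ∣ ((Spin.succ^[a] j : Spin s) : ℤ) - (j + a) := by
  induction a with
  | zero => simp
  | succ a ih =>
    rw [Function.iterate_succ_apply']
    set i := Spin.succ^[a] j
    obtain ⟨k, hk⟩ := ih
    have hi := Finset.mem_Icc.mp i.2
    unfold Spin.succ
    split_ifs with h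
    · exact ⟨k, by push_cast; linarith⟩
    · have : (i : ℤ) = s := by omega
      exact ⟨k - 1, by push_cast; linarith⟩

theorem Spin.succ_iterate_ne {s : ℕ} (j : Spin s) {a : ℕ} (ha : 0 < a) (ha' : a < 2 * s + 1) :
    Spin.succ^[a] j ≠ j := by
  intro h
  have := Spin.dvd_succ_iterate_sub j a
  rw [h] at this
  have h2 : (2 * s + 1 : ℤ) ∣ a := by
    obtain ⟨k, hk⟩ := this
    exact ⟨-k, by linarith⟩
  have := Int.le_of_dvd (by exact_mod_cast ha) h2
  omega

theorem pauliX_pow_apply (s a : ℕ) (i j : Spin s) :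
    (pauliX s ^ a) i j = if j = Spin.succ^[a] i then 1 else 0 := by
  induction a generalizing i with
  | zero =>
    rw [pow_zero, Matrix.one_apply, Function.iterate_zero_apply]
    exact if_congr eq_comm rfl rfl
  | succ a ih =>
    rw [pow_succ', Matrix.mul_apply, Function.iterate_succ_apply]
    rw [Finset.sum_eq_single i.succ (fun k _ hk => by simp [pauliX, hk])
      (fun h => absurd (Finset.mem_univ _) h), ih]
    simp [pauliX]

theorem pauli_factor_apply (s a b : ℕ) (i j : Spin s) :
    (pauliX s ^ a * pauliZ s ^ b) i j = (if j = Spin.succ^[a] i then 1 else 0) *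
      (Complex.exp (2 * Real.pi * Complex.I / (2 * s + 1)) ^ (j : ℤ)) ^ b := by
  rw [pauliZ, Matrix.diagonal_pow, Matrix.mul_diagonal, pauliX_pow_apply]
  rfl

section Codes

variable {s n : ℕ}

/-- Where `a k = 0` the factor is diagonal, so the two strings must agree there. -/
theorem hammingDist_le_of_pauli_ne_zero {a b : Fin n → Fin (2 * s + 1)} {c c' : Config s n}
    (h : pauli a b c c' ≠ 0) : hammingDist c c' ≤ hammingNorm a := by
  refine Finset.card_le_card fun k hk => ?_
  rw [Finset.mem_filter] at hk ⊢
  refine ⟨hk.1, fun hak => hk.2 ?_⟩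
  have := Finset.prod_ne_zero_iff.mp h k (Finset.mem_univ k)
  rw [pauli_factor_apply, hak] at this
  by_contra hne
  simp [Ne.symm hne] at this

/-- A nontrivial cyclic shift has no fixed letter. -/
theorem pauli_diag_eq_zero {a b : Fin n → Fin (2 * s + 1)} (ha : a ≠ 0) (c : Config s n) :
    pauli a b c c = 0 := by
  obtain ⟨k, hk⟩ := Function.ne_iff.mp ha
  refine Finset.prod_eq_zero (Finset.mem_univ k) ?_
  rw [pauli_factor_apply, if_neg, zero_mul]
  refine (Spin.succ_iterate_ne _ (Nat.pos_of_ne_zero fun h => hk (Fin.ext h)) (a k).2).symm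

theorem pauli_zero_zero_diag (c : Config s n) : pauli 0 0 c c = 1 := by
  simp [pauli]

theorem inner_ket_toEuclideanLin_ket (M : Op s n) (c c' : Config s n) :
    inner ℂ (ket c) (Matrix.toEuclideanLin M (ket c')) = M c c' := by
  simp [ket, EuclideanSpace.inner_single_left, Matrix.toLpLin_apply]

/-- Matrix elements of an operator that is diagonal on a code. -/
theorem inner_sqrtState {C : Finset (Config s n)} (M : Op s n)
    (hM : ∀ c ∈ C, ∀ c' ∈ C, c ≠ c' → M c c' = 0) (u v : C → ℝ) :
    inner ℂ (sqrtState u) (Matrix.toEuclideanLin M (sqrtState v)) =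
      ((1 / Real.sqrt (∑ c, u c) * (1 / Real.sqrt (∑ c, v c)) : ℝ) : ℂ) *
        ∑ c, ((Real.sqrt (u c) * Real.sqrt (v c) : ℝ) : ℂ) * M c.1 c.1 := by
  have hterm : ∀ c c' : C, inner ℂ (((Real.sqrt (u c) : ℝ) : ℂ) • ket c.1)
      (((Real.sqrt (v c') : ℝ) : ℂ) • Matrix.toEuclideanLin M (ket c'.1)) =
      if c = c' then ((Real.sqrt (u c) * Real.sqrt (v c) : ℝ) : ℂ) * M c.1 c.1 else 0 := by
    intro c c'
    rw [inner_smul_left, inner_smul_right, inner_ket_toEuclideanLin_ket, Complex.conj_ofReal]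
    split_ifs with h
    · subst h; push_cast; ring
    · rw [hM _ c.2 _ c'.2 fun e => h (Subtype.ext e)]; simp
  rw [sqrtState, sqrtState, map_smul, map_sum, inner_smul_left, inner_smul_right, sum_inner,
    Complex.conj_ofReal]
  simp_rw [map_smul, inner_sum, hterm]
  simp only [Finset.sum_ite_eq, Finset.mem_univ, if_true]
  push_cast
  ring

/-! ### Positive strings are ground states -/

/-- The vectors spanning the interaction are supported on pairs that contain the letter 0 or two
letters of opposite sign. -/
theorem interaction_apply_eq_zero {a b : Spin s} (ha : 0 < (a : ℤ)) (hb : 0 < (b : ℤ))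
    (p : Spin s × Spin s) : interaction s p (a, b) = 0 := by
  have ha0 : a ≠ Spin.zero s := fun h => by rw [h] at ha; exact absurd ha (lt_irrefl _)
  have hb0 : b ≠ Spin.zero s := fun h => by rw [h] at hb; exact absurd hb (lt_irrefl _)
  have h1 : ∀ m : Spin s, transportVec m (a, b) = 0 := by
    intro m
    simp [transportVec, ha0, hb0]
  have h2 : ∀ m : Spin s, 0 < (m : ℤ) → pairVec m (a, b) = 0 := by
    intro m hm
    have : b ≠ m.opp := fun h => by
      rw [h] at hb
      change 0 < -(m : ℤ) at hb
      omega
    simp [pairVec, ha0, this]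
  rw [interaction, Matrix.add_apply, Matrix.sum_apply, Matrix.sum_apply, Finset.sum_eq_zero,
    Finset.sum_eq_zero, add_zero]
  · intro m _
    split_ifs with hm
    · simp [rankOne, Matrix.vecMulVec_apply, h2 m hm]
    · rfl
  · intro m _
    simp [rankOne, Matrix.vecMulVec_apply, h1 m]

theorem ham_apply_eq_zero (J : ℝ) {c : Config s n} (hc : ∀ k, 0 < (c k : ℤ)) (c' : Config s n) :
    ham s n J c' c = 0 := by
  have hJ : hamJ s n J c' c = 0 := by
    rw [hamJ, Matrix.smul_apply, Matrix.sum_apply, Finset.sum_eq_zero, smul_zero]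
    intro k _
    have : Spin.zero s ≠ c k := fun h => by
      have := hc k; rw [← h] at this; exact absurd this (lt_irrefl _)
    simp [oneSite, this]
  have hS : hamS s n c' c = 0 := by
    rw [hamS, Matrix.sum_apply, Finset.sum_eq_zero]
    intro k _
    simp [twoSite, interaction_apply_eq_zero (hc _) (hc _)]
  rw [ham, Matrix.add_apply, hJ, hS, add_zero]

theorem ket_mem_groundSpace (J : ℝ) {c : Config s n} (hc : ∀ k, 0 < (c k : ℤ)) :
    ket c ∈ groundSpace s n J := by
  rw [groundSpace, LinearMap.mem_ker]
  ext c'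
  simp [ket, Matrix.toLpLin_apply, ham_apply_eq_zero J hc]

theorem sqrtState_mem_groundSpace (J : ℝ) {C : Finset (Config s n)}
    (hC : ∀ c ∈ C, ∀ k, 0 < (c k : ℤ)) (v : C → ℝ) : sqrtState v ∈ groundSpace s n J :=
  Submodule.smul_mem _ _ (Submodule.sum_mem _ fun c _ =>
    Submodule.smul_mem _ _ (ket_mem_groundSpace J (hC c.1 c.2)))

/-! ### From balanced vectors to quantum codes -/

section Balanced

variable {C : Finset (Config s n)} {x : C → ℝ}

theorem sum_pos_part_eq (h : ∑ c, x c = 0) : ∑ c, max (x c) 0 = ∑ c, max (-x c) 0 := by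
  rw [← sub_eq_zero, ← Finset.sum_sub_distrib]
  refine Eq.trans ?_ h
  refine Finset.sum_congr rfl fun c _ => ?_
  rcases le_total 0 (x c) with h | h
  · rw [max_eq_left h, max_eq_right (by linarith)]; ring
  · rw [max_eq_right h, max_eq_left (by linarith)]; ring

theorem sum_pos_part_pos (h : ∑ c, x c = 0) (hx : x ≠ 0) : 0 < ∑ c, max (x c) 0 := by
  have h0 : 0 ≤ ∑ c, max (x c) 0 := Finset.sum_nonneg fun _ _ => le_max_right _ _
  refine h0.lt_of_ne fun he => hx (funext fun c => ?_)
  have h1 := (Finset.sum_eq_zero_iff_of_nonneg fun c _ => le_max_right (x c) 0).mp he.symm c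
    (Finset.mem_univ c)
  have h2 := (Finset.sum_eq_zero_iff_of_nonneg fun c _ => le_max_right (-x c) 0).mp
    ((sum_pos_part_eq h).symm.trans he.symm) c (Finset.mem_univ c)
  have := le_max_left (x c) 0
  have := le_max_left (-x c) 0
  simp only [Pi.zero_apply]
  linarith

/-- An operator that is diagonal on the code, with diagonal orthogonal to the balanced vector,
satisfies the Knill–Laflamme conditions. -/
theorem knillLaflamme_of_balanced (M : Op s n) (hM : ∀ c ∈ C, ∀ c' ∈ C, c ≠ c' → M c c' = 0)
    (hsum : ∑ c, x c = 0) (hbal : ∑ c, (x c : ℂ) * M c.1 c.1 = 0) (i j : Fin 2) :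
    inner ℂ (logicalStates x i) (Matrix.toEuclideanLin M (logicalStates x j)) =
      if i = j then ((1 / ∑ c, max (x c) 0 : ℝ) : ℂ) * ∑ c, ((max (x c) 0 : ℝ) : ℂ) * M c.1 c.1
      else 0 := by
  have hS := sum_pos_part_eq hsum
  have h0 : 0 ≤ ∑ c, max (x c) 0 := Finset.sum_nonneg fun _ _ => le_max_right _ _
  -- Since `max (x c) 0 - max (-x c) 0 = x c`, balance says exactly that both logical states have
  -- the same expectation.
  have hM' : ∑ c, ((max (-x c) 0 : ℝ) : ℂ) * M c.1 c.1 =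
      ∑ c, ((max (x c) 0 : ℝ) : ℂ) * M c.1 c.1 := by
    rw [eq_comm, ← sub_eq_zero, ← Finset.sum_sub_distrib, ← hbal]
    refine Finset.sum_congr rfl fun c _ => ?_
    rw [← sub_mul, ← Complex.ofReal_sub]
    congr 2
    rcases le_total 0 (x c) with h | h
    · rw [max_eq_left h, max_eq_right (by linarith)]; ring
    · rw [max_eq_right h, max_eq_left (by linarith)]; ring
  have hdisj : ∀ c, Real.sqrt (max (x c) 0) * Real.sqrt (max (-x c) 0) = 0 := by
    intro c
    rcases le_total 0 (x c) with h | h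
    · rw [max_eq_right (by linarith : -x c ≤ 0), Real.sqrt_zero, mul_zero]
    · rw [max_eq_right h, Real.sqrt_zero, zero_mul]
  have hsq : ∀ y : ℝ, 0 ≤ y → 1 / Real.sqrt y * (1 / Real.sqrt y) = 1 / y := by
    intro y hy
    rw [one_div_mul_one_div, Real.mul_self_sqrt hy]
  fin_cases i <;> fin_cases j <;>
    simp only [logicalStates, Fin.zero_eta, Fin.mk_one, Matrix.cons_val_zero, Matrix.cons_val_one,
      inner_sqrtState M hM, if_true, zero_ne_one, one_ne_zero, if_false]
  · rw [hsq _ h0]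
    simp_rw [Real.mul_self_sqrt (le_max_right _ (0 : ℝ))]
  · simp_rw [hdisj]
    simp
  · simp_rw [mul_comm (Real.sqrt (max (-x _) 0)), hdisj]
    simp
  · rw [← hS, hsq _ h0]
    simp_rw [Real.mul_self_sqrt (le_max_right _ (0 : ℝ))]
    rw [hM']

theorem sum_eq_zero_of_constraintMatrix {d : ℝ} (hA : (constraintMatrix C d).mulVec x = 0) :
    ∑ c, x c = 0 := by
  have := congrFun hA (Sum.inl ())
  simpa [Matrix.mulVec, dotProduct, constraintMatrix] using this

theorem balanced_of_constraintMatrix {d : ℝ} (hA : (constraintMatrix C d).mulVec x = 0)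
    (b : Fin n → Fin (2 * s + 1)) (hb : (hammingNorm b : ℝ) < d) :
    ∑ c, (x c : ℂ) * pauli 0 b c.1 c.1 = 0 := by
  by_cases hb0 : b = 0
  · subst hb0
    simp_rw [pauli_zero_zero_diag, mul_one]
    exact_mod_cast sum_eq_zero_of_constraintMatrix hA
  -- As `x` is real, the complex equation splits into the `Re` row and the `Im` row.
  · have hrow := fun i => congrFun hA (Sum.inr (⟨b, hammingNorm_pos_iff.mpr hb0, hb⟩, i))
    have hre := hrow 0
    have him := hrow 1
    simp only [Matrix.mulVec, dotProduct, constraintMatrix, if_true, one_ne_zero, if_false,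
      Pi.zero_apply] at hre him
    apply Complex.ext
    · rw [Complex.re_sum, Complex.zero_re, ← hre]
      refine Finset.sum_congr rfl fun c _ => ?_
      rw [Complex.re_ofReal_mul, mul_comm]
    · rw [Complex.im_sum, Complex.zero_im, ← him]
      refine Finset.sum_congr rfl fun c _ => ?_
      rw [Complex.im_ofReal_mul, mul_comm]

theorem isGroundCode_logicalStates {d : ℝ} (J : ℝ) (hC : ∀ c ∈ C, ∀ k, 0 < (c k : ℤ))
    (hx : x ≠ 0) (hA : (constraintMatrix C d).mulVec x = 0) :
    IsGroundCode J (logicalStates x) := by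
  have hsum := sum_eq_zero_of_constraintMatrix hA
  refine ⟨orthonormal_iff_ite.mpr fun i j => ?_, fun i => ?_⟩
  -- Orthonormality is the Knill–Laflamme condition for the identity operator.
  · have h := knillLaflamme_of_balanced (x := x) (1 : Op s n)
      (fun c _ c' _ h => Matrix.one_apply_ne h) hsum
      (by simp_rw [Matrix.one_apply_eq, mul_one]; exact_mod_cast hsum) i j
    rw [Matrix.toLpLin_apply, Matrix.one_mulVec] at h
    rw [show inner ℂ (logicalStates x i) (logicalStates x j) = _ from h]
    simp_rw [Matrix.one_apply_eq, mul_one]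
    have h1 := (sum_pos_part_pos hsum hx).ne'
    split_ifs
    · rw [← Complex.ofReal_sum, ← Complex.ofReal_mul, one_div_mul_cancel h1, Complex.ofReal_one]
    · rfl
  · fin_cases i
    · exact sqrtState_mem_groundSpace J hC _
    · exact sqrtState_mem_groundSpace J hC _

theorem hasDistance_logicalStates {d : ℝ}
    (hdist : ∀ c ∈ C, ∀ c' ∈ C, c ≠ c' → d ≤ hammingDist c c')
    (hA : (constraintMatrix C d).mulVec x = 0) : HasDistance (logicalStates x) d := by
  intro a b ha hb
  refine ⟨_, knillLaflamme_of_balanced (pauli a b) ?_ (sum_eq_zero_of_constraintMatrix hA) ?_⟩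
  · intro c hc c' hc' hne
    by_contra h
    have h1 : (hammingDist c c' : ℝ) ≤ hammingNorm a := by
      exact_mod_cast hammingDist_le_of_pauli_ne_zero h
    linarith [hdist c hc c' hc' hne]
  · by_cases ha0 : a = 0
    · rw [ha0]
      exact balanced_of_constraintMatrix hA b hb
    · simp_rw [pauli_diag_eq_zero ha0, mul_zero, Finset.sum_const_zero]

end Balanced

theorem beta_pos (hs : 2 ≤ s) (b : ZMod 2) : 0 < (beta hs b : ℤ) := by
  unfold beta
  split_ifs
  · exact (by decide : (0 : ℤ) < 2)
  · exact (by decide : (0 : ℤ) < 1)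

theorem beta_injective (hs : 2 ≤ s) : Function.Injective (beta hs) := by
  have h : ∀ b : ZMod 2, ((beta hs b : Spin s) : ℤ) = if b = 0 then 2 else 1 := by
    intro b
    unfold beta
    split_ifs <;> rfl
  intro b b' hbb
  have := (h b).symm.trans ((congrArg _ hbb).trans (h b'))
  have key : ∀ b b' : ZMod 2, (if b = 0 then (2 : ℤ) else 1) = (if b' = 0 then 2 else 1) →
      b = b' := by decide
  exact key b b' this

end Codes

/-! ### Distance and size of truncated Justesen codes -/

section Justesen

variable {m n : ℕ}

/-- The `i`-th block of the Justesen codeword of `f`. -/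
noncomputable def justesenBlock (α : GaloisField 2 m)
    (e : GaloisField 2 m ≃ₗ[ZMod 2] (Fin m → ZMod 2)) (f : Polynomial (GaloisField 2 m)) (i : ℕ) :
    Fin (m + m) → ZMod 2 :=
  Fin.append (e (f.eval (α ^ i))) (e (α ^ i * f.eval (α ^ i)))

theorem justesenWord_eq_block (α : GaloisField 2 m)
    (e : GaloisField 2 m ≃ₗ[ZMod 2] (Fin m → ZMod 2)) (f : Polynomial (GaloisField 2 m)) (k : Fin n)
    (i : ℕ) (r : Fin (m + m)) (hk : (k : ℕ) = i * (2 * m) + r) :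
    justesenWord n α e f k = justesenBlock α e f i r := by
  have hr := r.2
  have hm : 0 < 2 * m := by omega
  have hdiv : (k : ℕ) / (2 * m) = i := by
    rw [hk, mul_comm, Nat.mul_add_div hm, Nat.div_eq_of_lt (by omega), add_zero]
  have hmod : (k : ℕ) % (2 * m) = r := by
    rw [hk, mul_comm, Nat.mul_add_mod, Nat.mod_eq_of_lt (by omega)]
  simp only [justesenWord, hdiv, hmod, justesenBlock]
  by_cases h : (r : ℕ) < m
  · rw [dif_pos h]
    exact (Fin.append_left _ _ ⟨r, h⟩).symm
  · have h' : (r : ℕ) - m < m := by omega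
    rw [dif_neg h, dif_pos h']
    have := (Fin.append_right (e (f.eval (α ^ i))) (e (α ^ i * f.eval (α ^ i))) ⟨r - m, h'⟩)
    rw [← this]
    congr 1
    ext
    simp
    omega

/-- Truncation may cut the last block; only the complete blocks are counted. -/
theorem sum_hammingNorm_block_le (α : GaloisField 2 m)
    (e : GaloisField 2 m ≃ₗ[ZMod 2] (Fin m → ZMod 2)) (f : Polynomial (GaloisField 2 m)) :
    ∑ i ∈ Finset.range (n / (2 * m)), hammingNorm (justesenBlock α e f i) ≤
      hammingNorm (justesenWord n α e f) := by
  have hlt : ∀ i < n / (2 * m), ∀ r < m + m, i * (2 * m) + r < n := by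
    intro i hi r hr
    have := Nat.div_mul_le_self n (2 * m)
    have h2 : (i + 1) * (2 * m) ≤ n / (2 * m) * (2 * m) := Nat.mul_le_mul_right _ hi
    rw [add_mul] at h2
    omega
  have hsum : ∑ i ∈ Finset.range (n / (2 * m)), hammingNorm (justesenBlock α e f i) =
      ((Finset.univ : Finset (Fin (n / (2 * m)))).sigma
        fun i => Finset.univ.filter fun r => justesenBlock α e f i r ≠ 0).card := by
    rw [Finset.sum_range, Finset.card_sigma]
    rfl
  rw [hsum]
  refine Finset.card_le_card_of_injOn
    (fun p => ⟨p.1 * (2 * m) + p.2, hlt _ p.1.2 _ p.2.2⟩) ?_ ?_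
  · rintro ⟨i, r⟩ hp
    have hr := (Finset.mem_filter.mp (Finset.mem_sigma.mp hp).2).2
    refine Finset.mem_filter.mpr ⟨Finset.mem_univ _, ?_⟩
    rwa [justesenWord_eq_block α e f _ i r rfl]
  · rintro ⟨i, r⟩ _ ⟨j, t⟩ _ hij
    have hij : (i : ℕ) * (2 * m) + r = j * (2 * m) + t := congrArg Fin.val hij
    have hr := r.2
    have ht := t.2
    have hij' : (i : ℕ) = j := by
      have := congrArg (· / (2 * m)) hij
      simpa only [mul_comm _ (2 * m), Nat.mul_add_div (by omega : 0 < 2 * m),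
        Nat.div_eq_of_lt (by omega : (r : ℕ) < 2 * m),
        Nat.div_eq_of_lt (by omega : (t : ℕ) < 2 * m), add_zero] using this
    have hrt : (r : ℕ) = t := by rw [hij'] at hij; omega
    obtain rfl := Fin.ext hij'
    obtain rfl := Fin.ext hrt
    rfl

/-- The two halves give `u` and `α ^ i * u`. If `u ≠ 0` their quotient is `α ^ i`, which determines
`i` below the order of `α`. -/
theorem justesenBlock_injOn {α : GaloisField 2 m} (hα : orderOf α = 2 ^ m - 1)
    (e : GaloisField 2 m ≃ₗ[ZMod 2] (Fin m → ZMod 2)) (f : Polynomial (GaloisField 2 m)) :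
    Set.InjOn (justesenBlock α e f) {i | i < 2 ^ m - 1 ∧ f.eval (α ^ i) ≠ 0} := by
  rintro i ⟨hi, hi0⟩ j ⟨hj, hj0⟩ hij
  have h1 := e.injective (funext fun r => by
    simpa [justesenBlock] using congrFun hij (Fin.castAdd m r) :
      e (f.eval (α ^ i)) = e (f.eval (α ^ j)))
  have h2 := e.injective (funext fun r => by
    have h := congrFun hij (Fin.natAdd m r)
    rwa [justesenBlock, justesenBlock, Fin.append_right, Fin.append_right] at h :
      e (α ^ i * f.eval (α ^ i)) = e (α ^ j * f.eval (α ^ j)))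
  rw [h1] at h2
  have := mul_right_cancel₀ hj0 h2
  exact pow_injOn_Iio_orderOf (by simpa [hα] using hi) (by simpa [hα] using hj) this

-- The evaluation points `α ^ i` are distinct, so each vanishing position is a separate root.
open Classical in
theorem card_roots_powers_le {α : GaloisField 2 m} (hα : orderOf α = 2 ^ m - 1)
    {f : Polynomial (GaloisField 2 m)} (hf : f ≠ 0) {N : ℕ} (hN : N ≤ 2 ^ m - 1) :
    ((Finset.range N).filter fun i => f.eval (α ^ i) = 0).card ≤ f.natDegree := by
  refine le_trans ?_ ((Multiset.toFinset_card_le _).trans (Polynomial.card_roots' f))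
  refine Finset.card_le_card_of_injOn (fun i => α ^ i) ?_ ?_
  · intro i hi
    simpa [hf] using (Finset.mem_filter.mp hi).2
  · intro i hi j hj hij
    have hi := Finset.mem_range.mp (Finset.mem_filter.mp hi).1
    have hj := Finset.mem_range.mp (Finset.mem_filter.mp hj).1
    exact pow_injOn_Iio_orderOf (by simp [hα]; omega) (by simp [hα]; omega) hij

/-- The weight of a truncated Justesen codeword: all but few blocks are nonzero, these are
distinct, and few vectors have small weight. -/
theorem hammingNorm_justesenWord_ge {α : GaloisField 2 m} (hα : orderOf α = 2 ^ m - 1)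
    (hm : m ≠ 0) (hn : n ≤ justesenLength m)
    (e : GaloisField 2 m ≃ₗ[ZMod 2] (Fin m → ZMod 2)) {f : Polynomial (GaloisField 2 m)}
    (hf : f ≠ 0) {K : ℕ} (hK : f.degree < (K + 1 : ℕ)) {l : ℝ} (hl0 : 0 < l) (hl : l ≤ 1 / 2) :
    l * (2 * m) * ((n / (2 * m) : ℕ) - K - Real.exp (2 * m * natEnt 2 l)) ≤
      hammingNorm (justesenWord n α e f) := by
  classical
  set N := n / (2 * m) with hNdef
  have hN : N ≤ 2 ^ m - 1 := by
    rw [hNdef]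
    refine Nat.div_le_of_le_mul ?_
    exact hn
  have hdeg : f.natDegree ≤ K := Nat.lt_succ_iff.mp ((Polynomial.natDegree_lt_iff_degree_lt hf).mpr hK)
  set Z := (Finset.range N).filter fun i => f.eval (α ^ i) = 0
  set S := (Finset.range N).filter fun i => f.eval (α ^ i) ≠ 0 ∧
    (hammingNorm (justesenBlock α e f i) : ℝ) ≤ l * (m + m : ℕ)
  set G := (Finset.range N).filter fun i =>
    l * (m + m : ℕ) < (hammingNorm (justesenBlock α e f i) : ℝ)
  have hZ : Z.card ≤ K := (card_roots_powers_le hα hf hN).trans hdeg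
  have hS : (S.card : ℝ) ≤ Real.exp (2 * m * natEnt 2 l) := by
    have h1 := card_hammingBall_le (α := ZMod 2) (m + m) hl0 (by simp [ZMod.card]) hl
    rw [ZMod.card] at h1
    push_cast at h1
    rw [← two_mul (m : ℝ)] at h1
    refine le_trans ?_ h1
    have : S.card ≤ (Finset.univ.filter fun z : Fin (m + m) → ZMod 2 =>
        (hammingNorm z : ℝ) ≤ l * (2 * m)).card := by
      refine Finset.card_le_card_of_injOn (justesenBlock α e f) ?_ ?_
      · intro i hi
        have := (Finset.mem_filter.mp hi).2.2
        push_cast at this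
        simpa [two_mul] using this
      · refine (justesenBlock_injOn hα e f).mono fun i hi => ?_
        have hi := Finset.mem_filter.mp hi
        exact ⟨(Finset.mem_range.mp hi.1).trans_le hN, hi.2.1⟩
    exact_mod_cast this
  -- Each position is a root of `f` (`Z`), a light nonzero block (`S`), or a heavy block (`G`).
  have hcover : N ≤ Z.card + S.card + G.card := by
    calc N = (Finset.range N).card := (Finset.card_range N).symm
      _ ≤ ((Z ∪ S) ∪ G).card := by
        refine Finset.card_le_card fun i hi => ?_
        by_cases h1 : f.eval (α ^ i) = 0
        · exact Finset.mem_union_left _ (Finset.mem_union_left _ (Finset.mem_filter.mpr ⟨hi, h1⟩))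
        · by_cases h2 : (hammingNorm (justesenBlock α e f i) : ℝ) ≤ l * (m + m : ℕ)
          · exact Finset.mem_union_left _
              (Finset.mem_union_right _ (Finset.mem_filter.mpr ⟨hi, h1, h2⟩))
          · exact Finset.mem_union_right _ (Finset.mem_filter.mpr ⟨hi, not_le.mp h2⟩)
      _ ≤ _ := (Finset.card_union_le _ _).trans (Nat.add_le_add_right (Finset.card_union_le _ _) _)
  have hG : l * (2 * m) * G.card ≤ hammingNorm (justesenWord n α e f) := by
    calc l * (2 * m) * G.card = ∑ i ∈ G, l * (m + m : ℕ) := by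
          rw [Finset.sum_const, nsmul_eq_mul]; push_cast; ring
      _ ≤ ∑ i ∈ G, (hammingNorm (justesenBlock α e f i) : ℝ) :=
          Finset.sum_le_sum fun i hi => (Finset.mem_filter.mp hi).2.le
      _ ≤ ∑ i ∈ Finset.range N, (hammingNorm (justesenBlock α e f i) : ℝ) :=
          Finset.sum_le_sum_of_subset_of_nonneg (Finset.filter_subset _ _)
            fun _ _ _ => Nat.cast_nonneg _
      _ ≤ _ := by exact_mod_cast sum_hammingNorm_block_le α e f
  refine le_trans (mul_le_mul_of_nonneg_left ?_ (by positivity)) hG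
  have h1 : (N : ℝ) ≤ Z.card + S.card + G.card := by exact_mod_cast hcover
  have h2 : (Z.card : ℝ) ≤ K := by exact_mod_cast hZ
  linarith

theorem justesenWord_sub (α : GaloisField 2 m)
    (e : GaloisField 2 m ≃ₗ[ZMod 2] (Fin m → ZMod 2)) (f g : Polynomial (GaloisField 2 m)) :
    justesenWord n α e (f - g) = justesenWord n α e f - justesenWord n α e g := by
  funext k
  simp only [justesenWord, Pi.sub_apply, Polynomial.eval_sub, map_sub, mul_sub]
  split_ifs <;> simp

theorem hammingDist_justesenWord_ge {s : ℕ} (hs : 2 ≤ s) {K : ℕ} {d : ℝ} {α : GaloisField 2 m}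
    {e : GaloisField 2 m ≃ₗ[ZMod 2] (Fin m → ZMod 2)}
    (h : ∀ f : Polynomial (GaloisField 2 m), f ≠ 0 → f.degree < K →
      d ≤ hammingNorm (justesenWord n α e f))
    {f g : Polynomial (GaloisField 2 m)} (hf : f.degree < K) (hg : g.degree < K) (hfg : f ≠ g) :
    d ≤ hammingDist (fun k => beta hs (justesenWord n α e f k))
      (fun k => beta hs (justesenWord n α e g k)) := by
  rw [hammingDist_comp (fun _ => beta hs) (fun _ => beta_injective hs), hammingDist_comm,
    hammingDist_eq_hammingNorm, neg_add_eq_sub, ← justesenWord_sub]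
  exact h _ (sub_ne_zero.mpr hfg) ((Polynomial.degree_sub_le _ _).trans_lt (max_lt hf hg))

theorem mem_justesenCode {s : ℕ} {hs : 2 ≤ s} {K : ℕ} {α : GaloisField 2 m}
    {e : GaloisField 2 m ≃ₗ[ZMod 2] (Fin m → ZMod 2)} {c : Config s n} :
    c ∈ justesenCode hs n K α e ↔ ∃ f : Polynomial (GaloisField 2 m), f.degree < K ∧
      c = fun k => beta hs (justesenWord n α e f k) := by
  simp [justesenCode]

/-- A positive distance makes the encoding injective on polynomials of degree below `K`. -/
theorem card_justesenCode {s : ℕ} (hs : 2 ≤ s) (hm : m ≠ 0) {K : ℕ} {d : ℝ} (hd : 0 < d)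
    {α : GaloisField 2 m} {e : GaloisField 2 m ≃ₗ[ZMod 2] (Fin m → ZMod 2)}
    (h : ∀ f : Polynomial (GaloisField 2 m), f ≠ 0 → f.degree < K →
      d ≤ hammingNorm (justesenWord n α e f)) :
    (2 ^ m) ^ K ≤ (justesenCode hs n K α e).card := by
  classical
  have hcard : Nat.card (Polynomial.degreeLT (GaloisField 2 m) K) = (2 ^ m) ^ K := by
    rw [Nat.card_congr (Polynomial.degreeLTEquiv (GaloisField 2 m) K).toEquiv, Nat.card_fun,
      GaloisField.card 2 m hm, Nat.card_fin]
  rw [← hcard]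
  have hmem : ∀ f : Polynomial.degreeLT (GaloisField 2 m) K,
      (fun k => beta hs (justesenWord n α e f.1 k)) ∈ justesenCode hs n K α e := fun f =>
    mem_justesenCode.mpr ⟨f.1, Polynomial.mem_degreeLT.mp f.2, rfl⟩
  refine (Nat.card_le_card_of_injective (fun f => (⟨_, hmem f⟩ : justesenCode hs n K α e))
    fun f g hfg => ?_).trans (by rw [Nat.card_eq_fintype_card, Fintype.card_coe])
  by_contra hne
  have hdist := hammingDist_justesenWord_ge hs h (Polynomial.mem_degreeLT.mp f.2)
    (Polynomial.mem_degreeLT.mp g.2) fun e => hne (Subtype.ext e)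
  have heq : (fun k => beta hs (justesenWord n α e f.1 k)) =
    fun k => beta hs (justesenWord n α e g.1 k) := congrArg Subtype.val hfg
  rw [heq, hammingDist_self, Nat.cast_zero] at hdist
  exact hd.not_ge hdist

end Justesen

/-! ### Entropy inequalities and asymptotics -/

theorem natEnt_eq_add (q x : ℝ) : natEnt q x = natEnt 2 x + x * Real.log (q - 1) := by
  have : Real.log ((2 : ℝ) - 1) = 0 := by norm_num
  rw [natEnt, natEnt, this, mul_zero, add_zero]

theorem natEnt_two_nonneg {x : ℝ} (h0 : 0 ≤ x) (h1 : x ≤ 1) : 0 ≤ natEnt 2 x := by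
  have : Real.log ((2 : ℝ) - 1) = 0 := by norm_num
  rw [natEnt, this]
  nlinarith [Real.log_nonpos h0 h1, Real.log_nonpos (by linarith : 0 ≤ 1 - x) (by linarith)]

theorem natEnt_nonneg {q x : ℝ} (hq : 2 ≤ q) (h0 : 0 ≤ x) (h1 : x ≤ 1) : 0 ≤ natEnt q x := by
  rw [natEnt_eq_add]
  exact add_nonneg (natEnt_two_nonneg h0 h1) (mul_nonneg h0 (Real.log_nonneg (by linarith)))

/-- Here `log (q - 1) ≥ 2 log 2`. This lets the rate hypothesis of the existence part force `2τ ≤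
1/2`, the range of the ball bound. -/
theorem mul_two_mul_log_two_le_natEnt {q x : ℝ} (hq : 5 ≤ q) (h0 : 0 ≤ x) (h1 : x ≤ 1) :
    x * (2 * Real.log 2) ≤ natEnt q x := by
  rw [natEnt_eq_add]
  have h4 : 2 * Real.log 2 ≤ Real.log (q - 1) := by
    rw [show 2 * Real.log 2 = Real.log (2 ^ 2) by rw [Real.log_pow]; norm_num]
    exact Real.log_le_log (by norm_num) (by linarith)
  nlinarith [natEnt_two_nonneg h0 h1, mul_le_mul_of_nonneg_left h4 h0]

theorem card_ball_spin_le (s n : ℕ) (hs : 2 ≤ s) {x : ℝ} (hx0 : 0 < x) (hx : x ≤ 1 / 2) :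
    ((Finset.univ.filter fun z : Fin n → Fin (2 * s + 1) => (hammingNorm z : ℝ) < x * n).card : ℝ) ≤
      Real.exp (n * natEnt (2 * s + 1) x) := by
  have h := card_openHammingBall_le (α := Fin (2 * s + 1)) n hx0
    (by rw [Fintype.card_fin]; omega) hx
  rw [Fintype.card_fin] at h
  exact_mod_cast h

/-- Ground codes from the Gilbert–Varshamov bound. -/
theorem exists_groundCode {s n : ℕ} (hs : 2 ≤ s) (hn : n ≠ 0) {x : ℝ} (hx0 : 0 < x)
    (hx : x ≤ 1 / 2)
    (h : n * (natEnt 2 x + natEnt (2 * s + 1) x) + Real.log 2 < n * Real.log 2) (J : ℝ) :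
    ∃ ψ : Fin 2 → State s n, IsGroundCode J ψ ∧ HasDistance ψ (x * n) := by
  classical
  have hd : 0 < x * n := by positivity
  obtain ⟨B, hB, hcard⟩ := exists_code_card_mul_ball_ge n (x * n) hd
  set g : (Fin n → ZMod 2) → Config s n := fun b k => beta hs (b k)
  have hg : Function.Injective g := fun b b' hbb =>
    funext fun k => beta_injective hs (congrFun hbb k)
  have hV2 := card_openHammingBall_le (α := ZMod 2) n hx0 (by simp [ZMod.card]) hx
  have hVq := card_ball_spin_le s n hs hx0 hx
  rw [ZMod.card] at hV2
  have hsize : 2 * (Finset.univ.filter fun z : Fin n → Fin (2 * s + 1) =>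
      (hammingNorm z : ℝ) < x * n).card ≤ (B.image g).card := by
    rw [Finset.card_image_of_injective _ hg]
    -- Otherwise `2 ^ n` is at most twice the product of the two ball sizes, which contradicts `h`
    -- after taking logarithms.
    by_contra hlt
    have hlt : (B.card : ℝ) ≤ 2 * (Finset.univ.filter fun z : Fin n → Fin (2 * s + 1) =>
      (hammingNorm z : ℝ) < x * n).card := by exact_mod_cast (not_le.mp hlt).le
    have h1 : (2 : ℝ) ^ n ≤ B.card * (Finset.univ.filter fun z : Fin n → ZMod 2 =>
        (hammingNorm z : ℝ) < x * n).card := by exact_mod_cast hcard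
    have h2 := h1.trans (mul_le_mul (hlt.trans (mul_le_mul_of_nonneg_left hVq two_pos.le)) hV2
      (Nat.cast_nonneg _) (by positivity))
    have h3 := Real.log_le_log (by positivity) h2
    rw [Real.log_pow, Real.log_mul (by positivity) (by positivity),
      Real.log_mul (by positivity) (by positivity), Real.log_exp, Real.log_exp] at h3
    push_cast at h3
    linarith
  obtain ⟨y, hy0, hy⟩ := exists_balanced (B.image g) (x * n) hd hsize
  refine ⟨logicalStates y, isGroundCode_logicalStates J ?_ hy0 hy,
    hasDistance_logicalStates ?_ hy⟩
  · intro c hc k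
    obtain ⟨b, -, rfl⟩ := Finset.mem_image.mp hc
    exact beta_pos hs _
  · intro c hc c' hc' hne
    obtain ⟨b, hb, rfl⟩ := Finset.mem_image.mp hc
    obtain ⟨b', hb', rfl⟩ := Finset.mem_image.mp hc'
    rw [hammingDist_comp (fun _ => beta hs) (fun _ => beta_injective hs)]
    exact hB b hb b' hb' fun e => hne (congrArg g e)

theorem justesenLength_mono : Monotone justesenLength := by
  intro a b h
  unfold justesenLength
  gcongr
  norm_num

theorem mul_two_pow_le_of_justesenLength_lt {m n : ℕ} (hm : 3 ≤ m)
    (h : justesenLength (m - 1) < n) : (m : ℝ) * 2 ^ m / 4 ≤ n := by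
  obtain ⟨k, rfl⟩ : ∃ k, m = k + 2 := ⟨m - 2, by omega⟩
  have hcast : ((justesenLength (k + 2 - 1) : ℕ) : ℝ) = 2 * (k + 1) * (2 ^ (k + 1) - 1) := by
    rw [justesenLength, show k + 2 - 1 = k + 1 by omega, Nat.cast_mul,
      Nat.cast_sub Nat.one_le_two_pow]
    push_cast
    ring
  have h1 : ((justesenLength (k + 2 - 1) : ℕ) : ℝ) ≤ n := by exact_mod_cast h.le
  rw [hcast] at h1
  refine le_trans ?_ h1
  have hp : (1 : ℝ) ≤ 2 ^ k := one_le_pow₀ (by norm_num)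
  have hk : (0 : ℝ) ≤ k := Nat.cast_nonneg k
  rw [pow_succ, pow_add]
  push_cast
  nlinarith [mul_le_mul_of_nonneg_left hp hk]

/-- `exp (2mh)` is exponentially smaller than `2 ^ m` because `2h < log 2`. -/
theorem eventually_const_add_exp_le {h δ : ℝ} (hh : h < Real.log 2 / 2) (hδ : 0 < δ) :
    ∀ᶠ m : ℕ in atTop, 8 + 4 * Real.exp (2 * m * h) ≤ δ * 2 ^ m := by
  have h1 : Tendsto (fun m : ℕ => 8 * (1 / 2 : ℝ) ^ m + 4 * Real.exp (2 * h - Real.log 2) ^ m)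
      atTop (𝓝 (8 * 0 + 4 * 0)) :=
    ((tendsto_pow_atTop_nhds_zero_of_lt_one (by norm_num) (by norm_num)).const_mul 8).add
      ((tendsto_pow_atTop_nhds_zero_of_lt_one (Real.exp_pos _).le
        ((Real.exp_lt_exp.mpr (by linarith)).trans_eq Real.exp_zero)).const_mul 4)
  have h2 := h1.eventually_le_const (show 8 * 0 + 4 * 0 < δ by simpa using hδ)
  filter_upwards [h2] with m hm
  have hp : (0 : ℝ) < 2 ^ m := by positivity
  calc 8 + 4 * Real.exp (2 * m * h)
      = (8 * (1 / 2 : ℝ) ^ m + 4 * Real.exp (2 * h - Real.log 2) ^ m) * 2 ^ m := by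
        have e1 : (1 / 2 : ℝ) ^ m * 2 ^ m = 1 := by rw [← mul_pow]; norm_num
        have e2 : Real.exp (2 * h - Real.log 2) ^ m * 2 ^ m = Real.exp (2 * m * h) := by
          rw [← mul_pow, Real.exp_sub, Real.exp_log two_pos, div_mul_cancel₀ _ two_ne_zero,
            ← Real.exp_nat_mul]
          congr 1
          ring
        rw [add_mul, mul_assoc 8, mul_assoc 4, e1, e2, mul_one]
    _ ≤ δ * 2 ^ m := mul_le_mul_of_nonneg_right hm hp.le

/-- The minimum distance of long truncated Justesen codes of outer dimension `outerDim R n m`. -/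
theorem eventually_hammingNorm_justesenWord_ge {τ : ℝ} (hτ : 0 < τ) (hR : 0 ≤ 1 / 2 - τ / 0.11)
    (M : ℕ) :
    ∀ᶠ n : ℕ in atTop, ∀ m : ℕ, justesenLength (m - 1) < n → n ≤ justesenLength m →
      M ≤ m ∧ ∀ (α : GaloisField 2 m) (e : GaloisField 2 m ≃ₗ[ZMod 2] (Fin m → ZMod 2)),
        orderOf α = 2 ^ m - 1 → ∀ f : Polynomial (GaloisField 2 m), f ≠ 0 →
          f.degree < outerDim (1 / 2 - τ / 0.11) n m →
            2 * τ * n ≤ hammingNorm (justesenWord n α e f) := by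
  obtain ⟨l, hl, hl2, hlE⟩ := exists_natEnt_two_lt
  set R : ℝ := 1 / 2 - τ / 0.11 with hRdef
  have hl0 : 0 < l := by linarith [show (0 : ℝ) < 0.11 by norm_num]
  have hδ : 0 < 2 * τ * (l / 0.11 - 1) := by
    have : 1 < l / 0.11 := by rwa [lt_div_iff₀ (by norm_num), one_mul]
    have : 0 < l / 0.11 - 1 := by linarith
    positivity
  obtain ⟨M₀, hM₀⟩ := eventually_atTop.mp (eventually_const_add_exp_le hlE hδ)
  filter_upwards [eventually_gt_atTop (justesenLength (max (max M₀ 3) M))] with n hn m hlo hhi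
  -- Large `n` forces large `m`, since `justesenLength` is monotone.
  have hmM : max (max M₀ 3) M < m := by
    by_contra hle
    exact absurd (hhi.trans (justesenLength_mono (not_lt.mp hle))) (not_le.mpr hn)
  have hm3 : 3 ≤ m := ((le_max_right _ _).trans (le_max_left _ _)).trans hmM.le
  have hmM₀ : M₀ ≤ m := ((le_max_left _ _).trans (le_max_left _ _)).trans hmM.le
  refine ⟨(le_max_right _ _).trans hmM.le, fun α e hα f hf hdeg => ?_⟩
  refine le_trans ?_ (hammingNorm_justesenWord_ge hα (by omega) hhi e hf hdeg hl0 hl2)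
  have hm0 : (0 : ℝ) < m := by exact_mod_cast (by omega : 0 < m)
  have hE := hM₀ m hmM₀
  set E := Real.exp (2 * m * natEnt 2 l)
  have hN : (n : ℝ) / (2 * m) - 1 ≤ (n / (2 * m) : ℕ) := by
    have h1 := Nat.lt_div_mul_add (a := n) (b := 2 * m) (by omega)
    have h2 : (n : ℝ) < (n / (2 * m) : ℕ) * (2 * m) + 2 * m := by exact_mod_cast h1
    rw [sub_le_iff_le_add, div_le_iff₀ (by positivity)]
    linarith
  have hK : ((⌈(n : ℝ) * R / m⌉₊ : ℕ) : ℝ) ≤ n * R / m + 1 :=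
    (Nat.ceil_lt_add_one (by positivity)).le
  have hnm := mul_two_pow_le_of_justesenLength_lt hm3 hlo
  -- As `1 - 2R = 2τ / 0.11`, the main term exceeds `2τn` by `2τ(l / 0.11 - 1)n`. The two roundings
  -- cost two blocks, that is `4m` bits, and the light blocks cost `2mE`. Both are absorbed because
  -- `n ≥ m 2 ^ m / 4`.
  calc 2 * τ * n ≤ l * (n * (2 * τ / 0.11) - 4 * m - 2 * m * E) := by
        have h1 : 2 * τ * (l / 0.11 - 1) * (m * 2 ^ m / 4) ≤ 2 * τ * (l / 0.11 - 1) * n :=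
          mul_le_mul_of_nonneg_left hnm hδ.le
        have h2 : m * (8 + 4 * E) ≤ m * (2 * τ * (l / 0.11 - 1) * 2 ^ m) :=
          mul_le_mul_of_nonneg_left hE hm0.le
        have h3 : l * (4 * m + 2 * m * E) ≤ 1 / 2 * (4 * m + 2 * m * E) :=
          mul_le_mul_of_nonneg_right hl2 (by positivity)
        have h4 : 2 * τ * (l / 0.11 - 1) * n = l * (n * (2 * τ / 0.11)) - 2 * τ * n := by ring
        rw [h4] at h1
        linarith
    _ = l * (2 * m) * (((n : ℝ) / (2 * m) - 1) - (n * R / m + 1) - E) := by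
        rw [hRdef]
        field_simp
        ring
    _ ≤ _ := by gcongr

end SpinChain

open SpinChain
-- The main theorem
theorem theorem2 (s : ℕ) (hs : 2 ≤ s) :
    (∃ ε : ℕ → ℝ, Tendsto ε atTop (𝓝 0) ∧
      ∀ (n : ℕ) (τ : ℝ), 0 < τ → τ ≤ 1 / 2 →
        Ent 2 (2 * τ) + Ent (2 * s + 1) (2 * τ) * Real.logb 2 (2 * s + 1) + ε n ≤ 1 →
        ∀ J : ℝ, 0 < J →
          ∃ ψ : Fin 2 → State s n, IsGroundCode J ψ ∧ HasDistance ψ (2 * τ * n)) ∧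
    (∀ τ : ℝ, 0 < τ → τ ≤ 1 / 2 →
      Real.logb 2 (2 * s + 1) * Ent (2 * s + 1) (2 * τ) ≤ 1 / 2 - τ / 0.11 →
      ∀ᶠ n : ℕ in atTop, ∀ m : ℕ, justesenLength (m - 1) < n → n ≤ justesenLength m →
        ∀ (α : GaloisField 2 m) (e : GaloisField 2 m ≃ₗ[ZMod 2] (Fin m → ZMod 2)),
          orderOf α = 2 ^ m - 1 →
          ∀ C : Finset (Config s n),
            C = justesenCode hs n (outerDim (1 / 2 - τ / 0.11) n m) α e →
            (∃ x : C → ℝ, x ≠ 0 ∧ (constraintMatrix C (2 * τ * n)).mulVec x = 0) ∧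
            ∀ x : C → ℝ, x ≠ 0 → (constraintMatrix C (2 * τ * n)).mulVec x = 0 →
              ∀ J : ℝ, 0 < J →
                IsGroundCode J (logicalStates x) ∧
                  HasDistance (logicalStates x) (2 * τ * n)) := by
  have hlog2 : 0 < Real.log 2 := Real.log_pos one_lt_two
  have hs5 : (5 : ℝ) ≤ 2 * s + 1 := by
    have : (2 : ℝ) ≤ s := by exact_mod_cast hs
    linarith
  have hEq : ∀ x : ℝ, Ent (2 * s + 1) x * Real.logb 2 (2 * s + 1) * Real.log 2 =
      natEnt (2 * s + 1) x := by
    intro x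
    have h := Ent_mul_log (2 * s + 1) (by omega) x
    push_cast at h
    rw [mul_assoc, Real.logb, div_mul_cancel₀ _ hlog2.ne', h]
  constructor
  -- For `n ≥ 1`, `n * ε n ≥ 2` pays for the factor 2 in `2V ≤ |C|` with strict inequality; `ε 0 =
  -- 4` makes the hypothesis fail at `n = 0`.
  · refine ⟨fun n => 4 / ((n : ℝ) + 1), ?_, ?_⟩
    · simpa [div_eq_mul_inv] using tendsto_one_div_add_atTop_nhds_zero_nat.const_mul (4 : ℝ)
    intro n τ hτ hτ2 h J _
    have h0 : 0 ≤ 2 * τ := by linarith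
    have h1 : 2 * τ ≤ 1 := by linarith
    have hE2 := Ent_mul_log 2 le_rfl (2 * τ)
    push_cast at hE2
    have hmain := mul_le_mul_of_nonneg_right h hlog2.le
    rw [add_mul, add_mul, hE2, hEq, one_mul] at hmain
    have e2 := natEnt_two_nonneg h0 h1
    have eq := mul_two_mul_log_two_le_natEnt hs5 h0 h1
    have hε : 0 < 4 / ((n : ℝ) + 1) := by positivity
    have hx : 2 * τ ≤ 1 / 2 := by
      by_contra hlt
      nlinarith [mul_pos hε hlog2]
    have hn : n ≠ 0 := by
      rintro rfl
      have := mul_nonneg h0 hlog2.le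
      norm_num at hmain
      linarith
    refine exists_groundCode hs hn (by positivity) hx ?_ J
    have hn1 : (1 : ℝ) ≤ n := by exact_mod_cast Nat.one_le_iff_ne_zero.mpr hn
    have hnε : 2 ≤ n * (4 / ((n : ℝ) + 1)) := by
      rw [← mul_div_assoc, le_div_iff₀ (by positivity)]
      linarith
    have := mul_le_mul_of_nonneg_left hmain (Nat.cast_nonneg (α := ℝ) n)
    nlinarith [mul_le_mul_of_nonneg_right hnε hlog2.le]
  · intro τ hτ hτ2 h
    have h0 : 0 ≤ 2 * τ := by linarith
    have h1 : 2 * τ ≤ 1 := by linarith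
    have hmain := mul_le_mul_of_nonneg_right h hlog2.le
    rw [mul_comm (Real.logb _ _), hEq] at hmain
    set R : ℝ := 1 / 2 - τ / 0.11 with hRdef
    -- Nonnegativity of the entropy gives `R ≥ 0`, hence `τ ≤ 0.055`.
    have hR : 0 ≤ R := by
      have := (natEnt_nonneg (by linarith : (2 : ℝ) ≤ 2 * s + 1) h0 h1).trans hmain
      exact nonneg_of_mul_nonneg_left this hlog2
    have hx : 2 * τ ≤ 1 / 2 := by
      have : τ / 0.11 ≤ 1 / 2 := by linarith
      rw [div_le_iff₀ (by norm_num)] at this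
      linarith
    filter_upwards [eventually_hammingNorm_justesenWord_ge hτ hR 1, eventually_gt_atTop 0]
      with n hn hn0 m hlo hhi α e hα C hC
    obtain ⟨hm, hweight⟩ := hn m hlo hhi
    have hweight := hweight α e hα
    have hd : 0 < 2 * τ * n := by
      have : (0 : ℝ) < n := by exact_mod_cast hn0
      positivity
    have hm0 : (0 : ℝ) < m := by exact_mod_cast hm
    subst hC
    refine ⟨exists_balanced _ _ hd ?_, fun x hx0 hA J _ =>
      ⟨isGroundCode_logicalStates J ?_ hx0 hA, hasDistance_logicalStates ?_ hA⟩⟩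
    · refine le_trans ?_ (card_justesenCode hs (by omega) hd hweight)
      have hV := card_ball_spin_le s n hs (by linarith : 0 < 2 * τ) hx
      -- The `+ 1` in `outerDim` adds `m ≥ 1` bits, which pay for the factor 2 in `2V ≤ |C|`.
      have hmK : (n : ℝ) * R + 1 ≤ m * outerDim R n m := by
        have h1 : (n : ℝ) * R / m ≤ ⌈(n : ℝ) * R / m⌉₊ := Nat.le_ceil _
        rw [div_le_iff₀ hm0] at h1
        have h2 : (1 : ℝ) ≤ m := by exact_mod_cast hm
        rw [outerDim]
        push_cast
        linarith
      have : (2 : ℝ) * (Finset.univ.filter fun z : Fin n → Fin (2 * s + 1) =>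
          (hammingNorm z : ℝ) < 2 * τ * n).card ≤ (2 ^ m) ^ outerDim R n m := by
        calc _ ≤ Real.exp (Real.log 2) * Real.exp (n * (R * Real.log 2)) := by
              rw [Real.exp_log two_pos]
              refine mul_le_mul_of_nonneg_left (hV.trans (Real.exp_le_exp.mpr ?_)) two_pos.le
              exact mul_le_mul_of_nonneg_left hmain (Nat.cast_nonneg n)
          _ ≤ Real.exp ((m * outerDim R n m) * Real.log 2) := by
              rw [← Real.exp_add]
              refine Real.exp_le_exp.mpr ?_
              nlinarith [mul_le_mul_of_nonneg_right hmK hlog2.le]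
          _ = _ := by
              rw [← pow_mul, ← Real.rpow_natCast, Real.rpow_def_of_pos two_pos]
              push_cast
              ring_nf
      exact_mod_cast this
    · intro c hc k
      obtain ⟨f, -, rfl⟩ := mem_justesenCode.mp hc
      exact beta_pos hs _
    · intro c hc c' hc' hne
      obtain ⟨f, hf, rfl⟩ := mem_justesenCode.mp hc
      obtain ⟨g, hg, rfl⟩ := mem_justesenCode.mp hc'
      exact hammingDist_justesenWord_ge hs hweight hf hg fun e => hne (by rw [e])
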